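/- **Conventions.** Signatures are finite and consist of relation symbols, constant symbols and possibly the unary function symbol $\mathrm{succ}$. A signature $\tau$ is *arithmetic* if it contains the binary relation symbol $<$, the ternary relation symbols $\mathrm{add}$ and $\mathrm{mult}$, the function symbol $\mathrm{succ}$ and the constant symbol $0$. For an arithmetic $\tau$, $\mathrm{struc}[\tau]$ is the class of all finite $\tau$-structures $\mathcal A$ in which $<$ is a (strict) linear ordering of the universe and the other arithmetic symbols have their natural meaning relative to it: writing $\mathrm{ind}(a)$ for the number of elements smaller than $a$, $0$ is the minimum, $\mathrm{succ}(a)$ is the next element after $a$ (and $a$ itself if $a$ is the maximum), $\mathrm{add}(a,b,c)$ holds iff $\mathrm{ind}(a)+\mathrm{ind}(b)=\mathrm{ind}(c)$, and $\mathrm{mult}(a,b,c)$ holds iff $\mathrm{ind}(a)\cdot\mathrm{ind}(b)=\mathrm{ind}(c)$. Let $\tau_{k\text{-colors}}=\tau\cup\{C_1,\dots,C_k\}$ with fresh unary relation symbols $C_i$. A *$k$-coloring* of a $\tau$-structure $\mathcal A$ is a $\tau_{k\text{-colors}}$-structure $\mathcal B$ whose $\tau$-restriction is $\mathcal A$ and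 in which the (possibly empty) sets $C_1^{\mathcal B},\dots,C_k^{\mathcal B}$ are pairwise disjoint and cover the universe. First-order formulas are built from atoms with $\neg,\wedge,\vee,\exists,\forall$; they are in *negation normal form* if $\neg$ is applied only to atoms. $\mathrm{qr}(\varphi)$ is the quantifier rank (the maximal nesting depth of quantifiers) and $\mathrm{bound}(\varphi)$ the set of variables bound by some quantifier in $\varphi$. **Theorem.** There is a constant $c\in\mathbb N$ such that the following holds for every arithmetic signature $\tau$ and every $k\in\mathbb N$. For each first-order $\tau_{k\text{-colors}}$-sentence $\varphi$ in negation normal form in which no $C_i$ occurs inside the scope of a universal quantifier, there is a first-order $\tau$-sentence $\varphi'$ such that 1. for all $\mathcal A\in\mathrm{struc}[\tau]$, we have $\mathcal A\models\varphi'$ if and only if there is a $k$-coloring $\mathcal B$ of $\mathcal A$ with $\mathcal B\models\varphi$; 2. $|\mathrm{qr}(\varphi')-\mathrm{qr}(\varphi)|\le c$; 3. $\bigl||\mathrm{bound}(\varphi')|-|\mathrm{bound}(\varphi)|\bigr|\le c$. -/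

import Mathlib

universe u v w

namespace ColorCoding

/-- First-order formulas over the signature `L` with *named* variables (the variables are the natural
numbers).  Names matter, because a variable may be quantified several times in a formula and the
number of distinct bound variables is counted.  -/
inductive NFormula (L : FirstOrder.Language.{u, v}) : Type (max u v)
  | equal : L.Term ℕ → L.Term ℕ → NFormula L
  | rel : {n : ℕ} → L.Relations n → (Fin n → L.Term ℕ) → NFormula L
  | neg : NFormula L → NFormula L
  | and : NFormula L → NFormula L → NFormula L
  | or : NFormula L → NFormula L → NFormula L
  | ex : ℕ → NFormula L → NFormula L
  | all : ℕ → NFormula L → NFormula L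

namespace NFormula

variable {L : FirstOrder.Language.{u, v}}

/-- Tarski semantics: truth of a formula in a structure under an assignment of its variables. -/
def Realize {A : Type w} [L.Structure A] : NFormula L → (ℕ → A) → Prop
  | equal s t, e => s.realize e = t.realize e
  | rel R ts, e => FirstOrder.Language.Structure.RelMap R (fun i => (ts i).realize e)
  | neg φ, e => ¬ φ.Realize e
  | and φ ψ, e => φ.Realize e ∧ ψ.Realize e
  | or φ ψ, e => φ.Realize e ∨ ψ.Realize e
  | ex x φ, e => ∃ a : A, φ.Realize (Function.update e x a)
  | all x φ, e => ∀ a : A, φ.Realize (Function.update e x a)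

/-- The free variables of a formula. -/
def free : NFormula L → Finset ℕ
  | equal s t => s.varFinset ∪ t.varFinset
  | rel _ ts => Finset.univ.biUnion fun i => (ts i).varFinset
  | neg φ => φ.free
  | and φ ψ => φ.free ∪ ψ.free
  | or φ ψ => φ.free ∪ ψ.free
  | ex x φ => φ.free.erase x
  | all x φ => φ.free.erase x

/-- The set of bound variables of a formula. -/
def bound : NFormula L → Finset ℕ
  | equal _ _ => ∅
  | rel _ _ => ∅
  | neg φ => φ.bound
  | and φ ψ => φ.bound ∪ ψ.bound
  | or φ ψ => φ.bound ∪ ψ.bound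
  | ex x φ => insert x φ.bound
  | all x φ => insert x φ.bound

/-- The quantifier rank of a formula. -/
def qr : NFormula L → ℕ
  | equal _ _ => 0
  | rel _ _ => 0
  | neg φ => φ.qr
  | and φ ψ => max φ.qr ψ.qr
  | or φ ψ => max φ.qr ψ.qr
  | ex _ φ => φ.qr + 1
  | all _ φ => φ.qr + 1

/-- A sentence is a formula without free variables. -/
def IsSentence (φ : NFormula L) : Prop := φ.free = ∅

/-- Atomic formulas. -/
def IsAtomic : NFormula L → Prop
  | equal _ _ => True
  | rel _ _ => True
  | _ => False

/-- Negation normal form: negations are applied only to atomic formulas. -/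
def IsNNF : NFormula L → Prop
  | equal _ _ => True
  | rel _ _ => True
  | neg φ => φ.IsAtomic
  | and φ ψ => φ.IsNNF ∧ ψ.IsNNF
  | or φ ψ => φ.IsNNF ∧ ψ.IsNNF
  | ex _ φ => φ.IsNNF
  | all _ φ => φ.IsNNF

end NFormula

/-- `A ⊨ φ`.  (For a sentence and a nonempty universe the assignment is irrelevant.) -/
def Models {L : FirstOrder.Language.{u, v}} (A : Type w) [L.Structure A] (φ : NFormula L) : Prop :=
  ∀ e : ℕ → A, φ.Realize e

/-- `L` is an arithmetic signature: a finite signature whose symbols are relation symbols, constant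
symbols and the unary function symbol `succ`, and which contains `<`, `add`, `mult`, `succ`, `0`. -/
structure ArithmeticSignature (L : FirstOrder.Language.{u, v}) where
  lt : L.Relations 2
  add : L.Relations 3
  mult : L.Relations 3
  succ : L.Functions 1
  zero : L.Constants
  add_ne_mult : add ≠ mult
  finite_relations : Finite (Σ n, L.Relations n)
  finite_constants : Finite L.Constants
  eq_succ : ∀ f : L.Functions 1, f = succ
  no_functions : ∀ n, 2 ≤ n → IsEmpty (L.Functions n)

namespace ArithmeticSignature

variable {L : FirstOrder.Language.{u, v}} (τ : ArithmeticSignature L) {A : Type w} [L.Structure A]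

/-- The interpretation of the symbol `<`. -/
def Lt (a b : A) : Prop := FirstOrder.Language.Structure.RelMap τ.lt ![a, b]

/-- The number represented by an element of a finite ordered universe: its number of
predecessors. -/
noncomputable def index (a : A) : ℕ := Set.ncard {b : A | τ.Lt b a}

/-- The structure `A` belongs to `struc[τ]`: it is finite, `<` is a linear ordering of the universe,
and the other arithmetic symbols have their natural meaning relative to this ordering. -/
structure IsStruc (A : Type w) [L.Structure A] : Prop where
  finite : Finite A
  irrefl : ∀ a : A, ¬ τ.Lt a a
  trans : ∀ a b c : A, τ.Lt a b → τ.Lt b c → τ.Lt a c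
  total : ∀ a b : A, τ.Lt a b ∨ a = b ∨ τ.Lt b a
  /-- `0` is the minimum -/
  zero_min : ∀ a : A, ¬ τ.Lt a (τ.zero : A)
  /-- the successor of the maximum is the maximum itself -/
  succ_max : ∀ a : A, (∀ b : A, ¬ τ.Lt a b) → FirstOrder.Language.Structure.funMap τ.succ ![a] = a
  /-- the successor of any other element is the next element -/
  succ_next : ∀ a b : A, τ.Lt a b →
    τ.Lt a (FirstOrder.Language.Structure.funMap τ.succ ![a]) ∧ ¬ τ.Lt b (FirstOrder.Language.Structure.funMap τ.succ ![a])
  add_iff : ∀ a b c : A,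
    FirstOrder.Language.Structure.RelMap τ.add ![a, b, c] ↔ τ.index a + τ.index b = τ.index c
  mult_iff : ∀ a b c : A,
    FirstOrder.Language.Structure.RelMap τ.mult ![a, b, c] ↔ τ.index a * τ.index b = τ.index c

end ArithmeticSignature

/-- The colour symbols `C_1, …, C_k`, all of them unary relation symbols. -/
inductive ColorRel (k : ℕ) : ℕ → Type
  | color : Fin k → ColorRel k 1

/-- The signature that consists of the `k` colour symbols only. -/
def colorLang (k : ℕ) : FirstOrder.Language.{0, 0} := ⟨fun _ => Empty, ColorRel k⟩

/-- The signature `L` extended by `k` fresh unary relation symbols. -/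
abbrev withColors (L : FirstOrder.Language.{u, v}) (k : ℕ) : FirstOrder.Language.{u, v} := L.sum (colorLang k)

/-- The symbol `C_i` of the extended signature. -/
def colorSymbol (L : FirstOrder.Language.{u, v}) {k : ℕ} (i : Fin k) : (withColors L k).Relations 1 :=
  Sum.inr (ColorRel.color i)

/-- `B` is a `k`-coloring of `A` (with the same universe): `A` is the restriction of `B` to the
signature `L`, and the (possibly empty) colour classes form a partition of the universe. -/
def IsColoring {L : FirstOrder.Language.{u, v}} {k : ℕ} {U : Type w} (A : L.Structure U)
    (B : (withColors L k).Structure U) : Prop :=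
  @FirstOrder.Language.LHom.reduct L (withColors L k) FirstOrder.Language.LHom.sumInl U B = A ∧
    ∀ a : U, ∃! i : Fin k, B.RelMap (colorSymbol L i) ![a]

namespace NFormula

variable {L : FirstOrder.Language.{u, v}} {k : ℕ}

/-- No colour symbol occurs in the formula. -/
def ColorFree : NFormula (withColors L k) → Prop
  | equal _ _ => True
  | rel (n := n) R _ => ∀ C : ColorRel k n, R ≠ Sum.inr C
  | neg φ => φ.ColorFree
  | and φ ψ => φ.ColorFree ∧ ψ.ColorFree
  | or φ ψ => φ.ColorFree ∧ ψ.ColorFree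
  | ex _ φ => φ.ColorFree
  | all _ φ => φ.ColorFree

/-- No colour symbol occurs inside the scope of a universal quantifier. -/
def NoColorInUniversalScope : NFormula (withColors L k) → Prop
  | equal _ _ => True
  | rel _ _ => True
  | neg φ => φ.NoColorInUniversalScope
  | and φ ψ => φ.NoColorInUniversalScope ∧ ψ.NoColorInUniversalScope
  | or φ ψ => φ.NoColorInUniversalScope ∧ ψ.NoColorInUniversalScope
  | ex _ φ => φ.NoColorInUniversalScope
  | all _ φ => φ.ColorFree

end NFormula

end ColorCoding

open ColorCoding

/-! The truth of `φ` under a given colouring depends only on the colours of at most `numAtoms φ`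
elements: an existential quantifier keeps its witness, negations sit on atoms, and universal
subformulas see no colours (`exists_witnesses`). So instead of a colouring one may guess a code that
is correct on a small set `X`.

With `m` bounding the size of `X` and `n` the size of the universe, a modulus `p` polylogarithmic in
`n` separates the indices in `X`. A Gödel-style pair `b`, `q`, again polylogarithmic, then assigns
prescribed colours to the residues by the Chinese remainder theorem. For large `n` all these numbers
are below `n`, so they are elements of the universe (`exists_coloring_code`). Three existential
quantifiers guess the code, and each colour atom is replaced by a formula computing `q mod ((x mod p
+ 1) * b + 1)`, whose six auxiliary variables are reused at every atom. This gives the constant 9.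
Universes too small for codes are handled by a disjunction over all colour tables, which costs no
quantifiers.

Conversely, no guess can do harm: the substituted formulas are made exclusive and exhaustive by
`least`, so every choice of parameters or table defines some colouring
(`exists_coloring_of_family`). -/

namespace ColorCoding
open Finset

/-! ### Number theory: small codes for colourings of small sets. -/

/-- A modulus `p`, logarithmic in the bound on the elements of `X`, separates `X`. -/
theorem exists_mod_injOn (m L : ℕ) (X : Finset ℕ) (hX : #X ≤ m) (hlt : ∀ x ∈ X, x < 2 ^ L) :
    ∃ p, 0 < p ∧ p ≤ 2 * (m ^ 2 * L + 1) ∧ Set.InjOn (· % p) (X : Set ℕ) := by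
  set N := m ^ 2 * L + 1 with hN
  set D := ∏ z ∈ X.offDiag, Nat.dist z.1 z.2 with hD
  have hDpos : D ≠ 0 := by
    refine Finset.prod_ne_zero_iff.2 fun z hz h => ?_
    exact (Finset.mem_offDiag.1 hz).2.2 (Nat.eq_of_dist_eq_zero h)
  have hDle : D ≤ 2 ^ (m ^ 2 * L) := by
    calc D ≤ ∏ z ∈ X.offDiag, 2 ^ L := by
          refine Finset.prod_le_prod' fun z hz => ?_
          obtain ⟨h1, h2, -⟩ := Finset.mem_offDiag.1 hz
          have := hlt _ h1
          have := hlt _ h2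
          unfold Nat.dist
          omega
      _ = (2 ^ L) ^ #X.offDiag := by simp
      _ ≤ (2 ^ L) ^ (m ^ 2) := by
          refine Nat.pow_le_pow_right (by positivity) ?_
          rw [Finset.offDiag_card]
          nlinarith [Nat.sub_le (#X * #X) #X]
      _ = 2 ^ (m ^ 2 * L) := by rw [← pow_mul, mul_comm]
  -- Prime powers dividing the central binomial coefficient of `N` are at most `2 * N`. If every
  -- positive number up to `2 * N` divided `D`, so would that coefficient, which is at least `4 ^ N
  -- / (2 * N) ≥ 2 ^ N`; but `D ≤ 2 ^ (N - 1)`.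
  obtain ⟨p, hp0, hpN, hpD⟩ : ∃ p, 0 < p ∧ p ≤ 2 * N ∧ ¬ p ∣ D := by
    by_contra! hall
    have hdvd : N.centralBinom ∣ D := by
      rw [Nat.dvd_iff_prime_pow_dvd_dvd]
      intro p j hp hj
      refine hall _ (pow_pos hp.pos _) ?_
      refine le_trans ?_ (Nat.pow_factorization_choose_le (p := p) (n := 2 * N) (k := N) (by omega))
      refine Nat.pow_le_pow_right hp.pos ?_
      exact (hp.pow_dvd_iff_le_factorization (Nat.centralBinom_ne_zero N)).1 hj
    have h1 := Nat.le_of_dvd (Nat.pos_of_ne_zero hDpos) hdvd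
    have h2 := Nat.four_pow_le_two_mul_self_mul_centralBinom N (by omega)
    have h3 : 2 * N ≤ 2 ^ N := by
      have : N - 1 < 2 ^ (N - 1) := Nat.lt_two_pow_self
      have h4 : 2 ^ N = 2 * 2 ^ (N - 1) := by
        rw [← pow_succ', Nat.sub_add_cancel (by omega)]
      omega
    have h4 : (4 : ℕ) ^ N = 2 ^ N * 2 ^ N := by rw [← mul_pow]; norm_num
    have h5 : 2 ^ N * 2 ^ N ≤ 2 ^ N * 2 ^ (m ^ 2 * L) := by
      rw [← h4]
      exact h2.trans (Nat.mul_le_mul h3 (h1.trans hDle))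
    have h6 := Nat.le_of_mul_le_mul_left h5 (by positivity)
    have h7 := (Nat.pow_le_pow_iff_right (by norm_num : 1 < 2)).1 h6
    omega
  refine ⟨p, hp0, hpN, fun x hx y hy hxy => ?_⟩
  by_contra hne
  refine hpD (Dvd.dvd.trans ?_ (Finset.dvd_prod_of_mem _
    (Finset.mem_offDiag.2 ⟨hx, hy, hne⟩ : (x, y) ∈ X.offDiag)))
  unfold Nat.dist
  have hxy' : x % p = y % p := hxy
  rcases le_total x y with h | h
  · rw [Nat.sub_eq_zero_of_le h, zero_add]
    exact (Nat.modEq_iff_dvd' h).1 hxy'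
  · rw [Nat.sub_eq_zero_of_le h, add_zero]
    exact (Nat.modEq_iff_dvd' h).1 hxy'.symm

/-- A variant of Gödel's `β` function: short sequences with small arguments have small codes. -/
theorem exists_beta_code {ι : Type*} (m k P : ℕ) (X : Finset ι) (r c : ι → ℕ) (hX : #X ≤ m)
    (hr : Set.InjOn r (X : Set ι)) (hrP : ∀ x ∈ X, r x < P) (hc : ∀ x ∈ X, c x < k) :
    ∃ b q, b ≤ (k + 1) * P ^ m ^ 2 ∧ q < (P * ((k + 1) * P ^ m ^ 2) + 1) ^ m ∧
      ∀ x ∈ X, c x < (r x + 1) * b + 1 ∧ q % ((r x + 1) * b + 1) = c x := by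
  classical
  rcases X.eq_empty_or_nonempty with rfl | hne
  · exact ⟨0, 0, by simp, by positivity, by simp⟩
  have hP : 0 < P := by
    obtain ⟨x, hx⟩ := hne
    exact (Nat.zero_le _).trans_lt (hrP x hx)
  set D := ∏ z ∈ X.offDiag, Nat.dist (r z.1) (r z.2) with hD
  have hDpos : 0 < D := by
    refine Finset.prod_pos fun z hz => Nat.pos_of_ne_zero fun h => ?_
    obtain ⟨h1, h2, h3⟩ := Finset.mem_offDiag.1 hz
    exact h3 (hr h1 h2 (Nat.eq_of_dist_eq_zero h))
  have hDle : D ≤ P ^ m ^ 2 := by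
    calc D ≤ ∏ z ∈ X.offDiag, P := by
          refine Finset.prod_le_prod' fun z hz => ?_
          obtain ⟨h1, h2, -⟩ := Finset.mem_offDiag.1 hz
          have := hrP _ h1
          have := hrP _ h2
          unfold Nat.dist
          omega
      _ = P ^ #X.offDiag := by simp
      _ ≤ P ^ m ^ 2 := by
          refine Nat.pow_le_pow_right hP ?_
          rw [Finset.offDiag_card]
          nlinarith [Nat.sub_le (#X * #X) #X]
  -- The factor `D` makes `b` divisible by all differences of residues, which yields coprime moduli;
  -- the factor `k + 1` makes every modulus exceed every colour.
  set b := (k + 1) * D with hb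
  have hble : b ≤ (k + 1) * P ^ m ^ 2 := Nat.mul_le_mul_left _ hDle
  have hkb : k < b := by nlinarith
  have hcop : Set.Pairwise (X : Set ι)
      (Function.onFun Nat.Coprime fun x => (r x + 1) * b + 1) := by
    intro x hx y hy hxy
    refine Nat.coprime_of_dvd fun p hp hpx hpy => ?_
    have hdist : Nat.dist (r x) (r y) ∣ b :=
      (Finset.dvd_prod_of_mem (fun z : ι × ι => Nat.dist (r z.1) (r z.2))
        (Finset.mem_offDiag.2 ⟨hx, hy, hxy⟩ : (x, y) ∈ X.offDiag)).trans (Dvd.intro_left _ rfl)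
    -- A common prime divisor divides the difference of the two moduli, which is `b` times a
    -- difference of residues; either factor leads to `p ∣ b`.
    have hpb : p ∣ b := by
      have key : p ∣ Nat.dist (r x) (r y) * b := by
        unfold Nat.dist
        rcases le_total (r x) (r y) with h | h
        · rw [Nat.sub_eq_zero_of_le h, zero_add, Nat.sub_mul]
          have := Nat.dvd_sub hpy hpx
          rwa [show (r y + 1) * b + 1 - ((r x + 1) * b + 1) = r y * b - r x * b by
            rw [Nat.add_sub_add_right, add_mul, add_mul, Nat.add_sub_add_right]] at this
        · rw [Nat.sub_eq_zero_of_le h, add_zero, Nat.sub_mul]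
          have := Nat.dvd_sub hpx hpy
          rwa [show (r x + 1) * b + 1 - ((r y + 1) * b + 1) = r x * b - r y * b by
            rw [Nat.add_sub_add_right, add_mul, add_mul, Nat.add_sub_add_right]] at this
      exact (hp.dvd_mul.1 key).elim (fun h => h.trans hdist) id
    have : p ∣ 1 := (Nat.dvd_add_right (hpb.mul_left (r x + 1))).1 hpx
    exact hp.one_lt.ne' (Nat.dvd_one.1 this)
  obtain ⟨q, hq⟩ := Nat.chineseRemainderOfFinset c (fun x => (r x + 1) * b + 1) X
    (fun _ _ => by omega) hcop
  have hprod : 0 < ∏ x ∈ X, ((r x + 1) * b + 1) := Finset.prod_pos fun _ _ => by omega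
  -- Reduction modulo the product bounds `q` without changing its residues.
  refine ⟨b, q % ∏ x ∈ X, ((r x + 1) * b + 1), hble, (Nat.mod_lt _ hprod).trans_le ?_,
    fun x hx => ?_⟩
  · calc ∏ x ∈ X, ((r x + 1) * b + 1) ≤ ∏ x ∈ X, (P * ((k + 1) * P ^ m ^ 2) + 1) := by
          refine Finset.prod_le_prod' fun x hx => ?_
          exact Nat.succ_le_succ (Nat.mul_le_mul (hrP x hx) hble)
      _ = (P * ((k + 1) * P ^ m ^ 2) + 1) ^ #X := by simp
      _ ≤ _ := Nat.pow_le_pow_right (by omega) hX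
  · have hlt : c x < (r x + 1) * b + 1 := by nlinarith [hc x hx]
    refine ⟨hlt, ?_⟩
    rw [Nat.mod_mod_of_dvd _ (Finset.dvd_prod_of_mem (fun x => (r x + 1) * b + 1) hx)]
    exact Eq.trans (hq x hx) (Nat.mod_eq_of_lt hlt)

-- The left side is polynomial in `L`. The exponent is `m + 1`, not `m`, so that the base itself is
-- bounded even when `m = 0`.
open Filter in
theorem eventually_polylog_lt (m k : ℕ) :
    ∀ᶠ L : ℕ in atTop,
      ((2 * (m ^ 2 * (L + 1) + 1)) * ((k + 1) * (2 * (m ^ 2 * (L + 1) + 1)) ^ m ^ 2) + 1) ^ (m + 1)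
        < 2 ^ L := by
  set K := (m ^ 2 + 1) * (m + 1) with hK
  set C := (k + 2) ^ (m + 1) * (2 * (2 * m ^ 2 + 1)) ^ K with hC
  have h := (tendsto_pow_const_div_const_pow_of_one_lt K (by norm_num : (1 : ℝ) < 2)).eventually
    (gt_mem_nhds (show (0 : ℝ) < 1 / (C + 1) by positivity))
  filter_upwards [h, eventually_ge_atTop 1] with L hL hL1
  have hP1 : 1 ≤ 2 * (m ^ 2 * (L + 1) + 1) := by omega
  have hP : 2 * (m ^ 2 * (L + 1) + 1) ≤ 2 * (2 * m ^ 2 + 1) * L := by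
    nlinarith [Nat.zero_le (m ^ 2), mul_le_mul_of_nonneg_left hL1 (Nat.zero_le (m ^ 2))]
  generalize 2 * (m ^ 2 * (L + 1) + 1) = P at *
  have h1 : (P * ((k + 1) * P ^ m ^ 2) + 1) ^ (m + 1) ≤ C * L ^ K := by
    calc (P * ((k + 1) * P ^ m ^ 2) + 1) ^ (m + 1)
        ≤ ((k + 2) * P ^ (m ^ 2 + 1)) ^ (m + 1) := by
          refine Nat.pow_le_pow_left ?_ _
          have h2 := Nat.one_le_pow (m ^ 2 + 1) P hP1
          have h3 : P * ((k + 1) * P ^ m ^ 2) = (k + 1) * P ^ (m ^ 2 + 1) := by ring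
          have h4 : (k + 2) * P ^ (m ^ 2 + 1) = (k + 1) * P ^ (m ^ 2 + 1) + P ^ (m ^ 2 + 1) := by
            ring
          omega
      _ = (k + 2) ^ (m + 1) * P ^ K := by rw [mul_pow, ← pow_mul]
      _ ≤ (k + 2) ^ (m + 1) * (2 * (2 * m ^ 2 + 1) * L) ^ K :=
          Nat.mul_le_mul_left _ (Nat.pow_le_pow_left hP _)
      _ = C * L ^ K := by rw [mul_pow, hC, mul_assoc]
  refine h1.trans_lt ?_
  rw [div_lt_div_iff₀ (by positivity) (by positivity)] at hL
  have hL' : L ^ K * (C + 1) < 1 * 2 ^ L := by exact_mod_cast hL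
  nlinarith [Nat.zero_le (L ^ K)]

/-- If `n` is large, every colouring of a small set of numbers below `n` is given by three
numbers below `n`. -/
theorem exists_coloring_code (m k : ℕ) : ∃ N₀, ∀ n, N₀ < n → ∀ (X : Finset ℕ) (c : ℕ → ℕ), #X ≤ m →
    (∀ x ∈ X, x < n) → (∀ x ∈ X, c x < k) →
    ∃ p b q, 0 < p ∧ p < n ∧ b < n ∧ q < n ∧ ∀ x ∈ X, (x % p + 1) * b + 1 < n ∧
      c x < (x % p + 1) * b + 1 ∧ q % ((x % p + 1) * b + 1) = c x := by
  obtain ⟨L₀, hL₀⟩ := Filter.eventually_atTop.1 (eventually_polylog_lt m k)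
  refine ⟨2 ^ L₀, fun n hn X c hX hXn hc => ?_⟩
  have hn0 : n ≠ 0 := (pos_of_gt hn).ne'
  have hL := hL₀ (Nat.log 2 n) (Nat.le_log_of_pow_le (by norm_num) hn.le)
  have hLn : 2 ^ Nat.log 2 n ≤ n := Nat.pow_log_le_self 2 hn0
  obtain ⟨p, hp0, hp, hinj⟩ := exists_mod_injOn m (Nat.log 2 n + 1) X hX fun x hx =>
    (hXn x hx).trans (Nat.lt_pow_succ_log_self (by norm_num) n)
  generalize 2 * (m ^ 2 * (Nat.log 2 n + 1) + 1) = P at *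
  obtain ⟨b, q, hb, hq, h⟩ := exists_beta_code m k P X (· % p) c hX hinj
    (fun x _ => (Nat.mod_lt x hp0).trans_le hp) hc
  have hP : 0 < P := by omega
  set S := P * ((k + 1) * P ^ m ^ 2) with hS
  have hT : 0 < (k + 1) * P ^ m ^ 2 := by positivity
  have hPS : P ≤ S := Nat.le_mul_of_pos_right _ hT
  have hbS : (k + 1) * P ^ m ^ 2 ≤ S := Nat.le_mul_of_pos_left _ hP
  -- The moduli, not only `p`, `b` and `q`, must stay below `n`, since the formula names them by
  -- elements.
  have hSn : S + 1 < n :=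
    (Nat.le_self_pow (Nat.succ_ne_zero m) _).trans_lt (hL.trans_le hLn)
  have hSm : (S + 1) ^ m < n :=
    (Nat.pow_le_pow_right (Nat.succ_pos S) (Nat.le_succ m)).trans_lt (hL.trans_le hLn)
  refine ⟨p, b, q, hp0, by omega, by omega, by omega, fun x hx => ⟨?_, h x hx⟩⟩
  have : (x % p + 1) * b ≤ S :=
    Nat.mul_le_mul ((Nat.mod_lt x hp0).trans_le hp) hb
  omega

/-! ### Formulas with named variables: coincidence lemma and syntactic bounds. -/

open FirstOrder FirstOrder.Language

variable {L : FirstOrder.Language.{u, v}}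

theorem Term.realize_congr {A : Type w} [L.Structure A] {e e' : ℕ → A} :
    ∀ t : L.Term ℕ, (∀ x ∈ t.varFinset, e x = e' x) → t.realize e = t.realize e'
  | .var x, h => h x (by simp [Term.varFinset])
  | .func f ts, h => by
    simp only [Term.realize]
    congr 1
    funext i
    refine realize_congr (ts i) fun x hx => h x ?_
    simp only [Term.varFinset, mem_biUnion, mem_univ, true_and]
    exact ⟨i, hx⟩

namespace NFormula

theorem realize_congr {A : Type w} [L.Structure A] (φ : NFormula L) {e e' : ℕ → A}
    (h : ∀ x ∈ φ.free, e x = e' x) : φ.Realize e ↔ φ.Realize e' := by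
  have upd : ∀ (ψ : NFormula L) (x : ℕ) (e e' : ℕ → A), (∀ y ∈ ψ.free.erase x, e y = e' y) →
      ∀ a, ∀ y ∈ ψ.free, Function.update e x a y = Function.update e' x a y := by
    intro ψ x e e' h a y hy
    by_cases hyx : y = x
    · subst hyx; simp
    · simpa [hyx] using h y (mem_erase.2 ⟨hyx, hy⟩)
  induction φ generalizing e e' with
  | equal s t =>
    simp only [free, mem_union] at h
    simp only [Realize]
    rw [Term.realize_congr s fun x hx => h x (Or.inl hx),
      Term.realize_congr t fun x hx => h x (Or.inr hx)]
  | rel R ts =>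
    simp only [free, mem_biUnion, mem_univ, true_and] at h
    simp only [Realize]
    rw [funext fun i => Term.realize_congr (ts i) fun x hx => h x ⟨i, hx⟩]
  | neg φ ih => exact not_congr (ih h)
  | and φ ψ ih₁ ih₂ =>
    simp only [free, mem_union] at h
    exact and_congr (ih₁ fun x hx => h x (Or.inl hx)) (ih₂ fun x hx => h x (Or.inr hx))
  | or φ ψ ih₁ ih₂ =>
    simp only [free, mem_union] at h
    exact or_congr (ih₁ fun x hx => h x (Or.inl hx)) (ih₂ fun x hx => h x (Or.inr hx))
  | ex x φ ih => exact exists_congr fun a => ih (upd φ x e e' h a)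
  | all x φ ih => exact forall_congr' fun a => ih (upd φ x e e' h a)

theorem IsSentence.models_iff {A : Type w} [L.Structure A] {φ : NFormula L} (hφ : φ.IsSentence)
    (e : ℕ → A) : Models A φ ↔ φ.Realize e :=
  ⟨fun h => h e, fun h e' => (φ.realize_congr (by simp [show φ.free = ∅ from hφ])).1 h⟩

/-- All variables that occur in a formula. -/
def vars : NFormula L → Finset ℕ
  | equal s t => s.varFinset ∪ t.varFinset
  | rel _ ts => Finset.univ.biUnion fun i => (ts i).varFinset
  | neg φ => φ.vars
  | and φ ψ => φ.vars ∪ ψ.vars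
  | or φ ψ => φ.vars ∪ ψ.vars
  | ex x φ => insert x φ.vars
  | all x φ => insert x φ.vars

/-- The formula has its free variables in `F`, its bound variables in `S` and quantifier rank at
most `n`. -/
structure Within (F S : Finset ℕ) (n : ℕ) (φ : NFormula L) : Prop where
  free_subset : φ.free ⊆ F
  bound_subset : φ.bound ⊆ S
  qr_le : φ.qr ≤ n

namespace Within

variable {F F' S S' : Finset ℕ} {n n' : ℕ} {φ ψ : NFormula L}

theorem mono (h : φ.Within F S n) (hF : F ⊆ F') (hS : S ⊆ S') (hn : n ≤ n') :
    φ.Within F' S' n' :=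
  ⟨h.1.trans hF, h.2.trans hS, h.3.trans hn⟩

theorem neg (h : φ.Within F S n) : φ.neg.Within F S n := ⟨h.1, h.2, h.3⟩

theorem and (h : φ.Within F S n) (h' : ψ.Within F S n) : (φ.and ψ).Within F S n :=
  ⟨union_subset h.1 h'.1, union_subset h.2 h'.2, max_le h.3 h'.3⟩

theorem or (h : φ.Within F S n) (h' : ψ.Within F S n) : (φ.or ψ).Within F S n :=
  ⟨union_subset h.1 h'.1, union_subset h.2 h'.2, max_le h.3 h'.3⟩

theorem ex {x : ℕ} (h : φ.Within (insert x F) S n) (hx : x ∈ S) : (φ.ex x).Within F S (n + 1) :=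
  ⟨(erase_subset_erase x h.1).trans (erase_insert_subset x F), insert_subset hx h.2,
    Nat.succ_le_succ h.3⟩

theorem equal {s t : L.Term ℕ} (hs : s.varFinset ⊆ F) (ht : t.varFinset ⊆ F) :
    (NFormula.equal s t).Within F S n :=
  ⟨union_subset hs ht, by simp [bound], by simp [qr]⟩

theorem rel {m : ℕ} {R : L.Relations m} {ts : Fin m → L.Term ℕ}
    (h : ∀ i, (ts i).varFinset ⊆ F) : (NFormula.rel R ts).Within F S n :=
  ⟨by simpa [free] using h, by simp [bound], by simp [qr]⟩

end Within

end NFormula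

/-! ### Numerals, finite disjunctions and exclusive choice. -/

namespace ArithmeticSignature

open NFormula

variable (τ : ArithmeticSignature L)

/-- The term `succ (succ (⋯ 0))`. -/
def numeral : ℕ → L.Term ℕ
  | 0 => τ.zero.term
  | j + 1 => τ.succ.apply₁ (numeral j)

theorem varFinset_apply (t : L.Term ℕ) : (τ.succ.apply₁ t).varFinset = t.varFinset := by
  simp [Functions.apply₁, Term.varFinset]

theorem varFinset_numeral (j : ℕ) : (τ.numeral j).varFinset = ∅ := by
  induction j with
  | zero => simp [numeral, Constants.term, Term.varFinset]
  | succ j ih => rw [numeral, varFinset_apply, ih]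

/-- A sentence without quantifiers that is true in all structures. -/
def verum : NFormula L := .equal τ.zero.term τ.zero.term

/-- The disjunction of a list of formulas. -/
def disj : List (NFormula L) → NFormula L
  | [] => τ.verum.neg
  | φ :: l => φ.or (disj l)

theorem within_verum {F S : Finset ℕ} {n : ℕ} : τ.verum.Within F S n :=
  .equal (by simp [Constants.term, Term.varFinset]) (by simp [Constants.term, Term.varFinset])

theorem within_disj {F S : Finset ℕ} {n : ℕ} :
    ∀ {l : List (NFormula L)}, (∀ φ ∈ l, φ.Within F S n) → (τ.disj l).Within F S n
  | [], _ => τ.within_verum.neg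
  | φ :: l, h => (h φ (by simp)).or (within_disj fun ψ hψ => h ψ (by simp [hψ]))

section Realize

variable {A : Type w} [L.Structure A]

theorem realize_verum (e : ℕ → A) : τ.verum.Realize e := rfl

theorem realize_disj (e : ℕ → A) :
    ∀ l : List (NFormula L), (τ.disj l).Realize e ↔ ∃ φ ∈ l, φ.Realize e
  | [] => by simp [disj, Realize, realize_verum]
  | φ :: l => by simp [disj, Realize, realize_disj e l]

end Realize

/-- The formula `Q i`, made exclusive: `i` is the least index with `Q i`, or the last index. -/
def least {k : ℕ} (Q : Fin k → NFormula L) (i : Fin k) : NFormula L :=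
  ((Q i).or (if (i : ℕ) + 1 = k then τ.verum else τ.verum.neg)).and
    (τ.disj (((List.finRange k).filter (· < i)).map Q)).neg

theorem within_least {k : ℕ} {Q : Fin k → NFormula L} {F S : Finset ℕ} {n : ℕ}
    (h : ∀ i, (Q i).Within F S n) (i : Fin k) : (τ.least Q i).Within F S n := by
  refine ((h i).or ?_).and (τ.within_disj fun φ hφ => ?_).neg
  · split_ifs
    exacts [τ.within_verum, τ.within_verum.neg]
  · obtain ⟨j, -, rfl⟩ := List.mem_map.1 hφ
    exact h j

theorem realize_least {A : Type w} [L.Structure A] {k : ℕ} (Q : Fin k → NFormula L) (i : Fin k)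
    (e : ℕ → A) : (τ.least Q i).Realize e ↔
      ((Q i).Realize e ∨ (i : ℕ) + 1 = k) ∧ ∀ j < i, ¬ (Q j).Realize e := by
  have : (if (i : ℕ) + 1 = k then τ.verum else τ.verum.neg).Realize e ↔ (i : ℕ) + 1 = k := by
    split_ifs with h <;> simp [Realize, realize_verum, h]
  simp [least, Realize, this, realize_disj]

end ArithmeticSignature

/-- The last index acts as default colour, so for `0 < k` there is always a candidate; its
minimality forces uniqueness. -/
theorem existsUnique_least {k : ℕ} (hk : 0 < k) (P : Fin k → Prop) :
    ∃! i : Fin k, (P i ∨ (i : ℕ) + 1 = k) ∧ ∀ j < i, ¬ P j := by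
  classical
  obtain ⟨i, hi, hmin⟩ := WellFounded.has_min (wellFounded_lt (α := Fin k))
    {i : Fin k | P i ∨ (i : ℕ) + 1 = k} ⟨⟨k - 1, by omega⟩, Or.inr (by simp; omega)⟩
  refine ⟨i, ⟨hi, fun j hj hP => hmin j (Or.inl hP) hj⟩, fun j ⟨h1, h2⟩ => ?_⟩
  rcases lt_trichotomy i j with h | h | h
  · rcases hi with hi | hi
    · exact absurd hi (h2 i h)
    · have := j.2
      have : (i : ℕ) < j := h
      omega
  · exact h.symm
  · exact absurd h (hmin j h1)

/-- Where the family already names exactly one colour, making it exclusive changes nothing. -/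
theorem least_iff_of_forall {k : ℕ} {P : Fin k → Prop} {c : Fin k} (h : ∀ i, P i ↔ c = i)
    (i : Fin k) : ((P i ∨ (i : ℕ) + 1 = k) ∧ ∀ j < i, ¬ P j) ↔ c = i := by
  have hc : (P c ∨ (c : ℕ) + 1 = k) ∧ ∀ j < c, ¬ P j :=
    ⟨Or.inl ((h c).2 rfl), fun j hj hP => hj.ne' ((h j).1 hP)⟩
  refine ⟨fun hi => (existsUnique_least c.pos P).unique hc hi, ?_⟩
  rintro rfl
  exact hc

/-! ### Substituting formulas for colour atoms. -/

section Translate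

variable {k : ℕ}

/-- Terms of the extended signature are terms of the original one. -/
def eraseTerm : (withColors L k).Term ℕ → L.Term ℕ
  | .var x => .var x
  | .func (Sum.inl f) ts => .func f fun i => eraseTerm (ts i)
  | .func (Sum.inr f) _ => Empty.elim f

theorem varFinset_eraseTerm :
    ∀ t : (withColors L k).Term ℕ, (eraseTerm t).varFinset = t.varFinset
  | .var x => rfl
  | .func (Sum.inl f) ts => by
    simp only [eraseTerm, Term.varFinset]
    exact biUnion_congr rfl fun i _ => varFinset_eraseTerm (ts i)
  | .func (Sum.inr f) _ => Empty.elim f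

/-- Replace every colour atom `C_i(t)` by the formula `χ i t`. -/
def translate (χ : Fin k → L.Term ℕ → NFormula L) : NFormula (withColors L k) → NFormula L
  | .equal s t => .equal (eraseTerm s) (eraseTerm t)
  | .rel (Sum.inl R) ts => .rel R fun i => eraseTerm (ts i)
  | .rel (Sum.inr (.color i)) ts => χ i (eraseTerm (ts 0))
  | .neg φ => .neg (translate χ φ)
  | .and φ ψ => .and (translate χ φ) (translate χ ψ)
  | .or φ ψ => .or (translate χ φ) (translate χ ψ)
  | .ex x φ => .ex x (translate χ φ)
  | .all x φ => .all x (translate χ φ)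

variable (χ : Fin k → L.Term ℕ → NFormula L)

theorem bound_subset_translate (φ : NFormula (withColors L k)) :
    φ.bound ⊆ (translate χ φ).bound := by
  induction φ with
  | equal s t => simp [NFormula.bound]
  | rel R ts => simp [NFormula.bound]
  | neg φ ih => exact ih
  | and φ ψ ih₁ ih₂ => exact union_subset_union ih₁ ih₂
  | or φ ψ ih₁ ih₂ => exact union_subset_union ih₁ ih₂
  | ex x φ ih => exact insert_subset_insert x ih
  | all x φ ih => exact insert_subset_insert x ih

theorem qr_le_translate (φ : NFormula (withColors L k)) : φ.qr ≤ (translate χ φ).qr := by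
  induction φ with
  | equal s t => simp [NFormula.qr]
  | rel R ts => simp [NFormula.qr]
  | neg φ ih => exact ih
  | and φ ψ ih₁ ih₂ => exact max_le_max ih₁ ih₂
  | or φ ψ ih₁ ih₂ => exact max_le_max ih₁ ih₂
  | ex x φ ih => exact Nat.succ_le_succ ih
  | all x φ ih => exact Nat.succ_le_succ ih

/-- All substituted formulas share the parameters `F`, the bound variables `S` and the rank bound
`n`, so the number of colour atoms does not enter. -/
theorem within_translate {F S : Finset ℕ} {n : ℕ} (φ : NFormula (withColors L k))
    (h : ∀ i (t : L.Term ℕ), t.varFinset ⊆ φ.vars → (χ i t).Within (t.varFinset ∪ F) S n) :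
    (translate χ φ).Within (φ.free ∪ F) (φ.bound ∪ S) (φ.qr + n) := by
  induction φ with
  | equal s t =>
    refine .equal ?_ ?_ <;> rw [varFinset_eraseTerm] <;> intro x hx <;>
      simp [NFormula.free, hx]
  | rel R ts =>
    rcases R with R | R
    · refine .rel fun i => ?_
      rw [varFinset_eraseTerm]
      exact (subset_biUnion_of_mem (fun i => (ts i).varFinset) (mem_univ i)).trans
        subset_union_left
    · obtain ⟨i⟩ : ColorRel k _ := R
      have hsub : (eraseTerm (ts 0)).varFinset ⊆ univ.biUnion fun i => (ts i).varFinset := by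
        rw [varFinset_eraseTerm]
        exact subset_biUnion_of_mem (fun i => (ts i).varFinset) (mem_univ 0)
      exact (h i _ hsub).mono (union_subset_union_left hsub) subset_union_right (by simp)
  | neg φ ih => exact (ih h).neg
  | and φ ψ ih₁ ih₂ =>
    refine ((ih₁ fun i t ht => h i t (ht.trans subset_union_left)).mono ?_ ?_ ?_).and
      ((ih₂ fun i t ht => h i t (ht.trans subset_union_right)).mono ?_ ?_ ?_) <;>
    first
    | (intro x hx; simp only [NFormula.free, NFormula.bound, mem_union] at hx ⊢; tauto)
    | simp [NFormula.qr]
  | or φ ψ ih₁ ih₂ =>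
    refine ((ih₁ fun i t ht => h i t (ht.trans subset_union_left)).mono ?_ ?_ ?_).or
      ((ih₂ fun i t ht => h i t (ht.trans subset_union_right)).mono ?_ ?_ ?_) <;>
    first
    | (intro x hx; simp only [NFormula.free, NFormula.bound, mem_union] at hx ⊢; tauto)
    | simp [NFormula.qr]
  | ex x φ ih =>
    obtain ⟨h1, h2, h3⟩ := ih fun i t ht => h i t (ht.trans (subset_insert _ _))
    refine ⟨fun y hy => ?_, ?_, ?_⟩
    · have := @h1 y
      simp only [translate, NFormula.free, mem_erase, mem_union] at hy this ⊢
      tauto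
    · simpa only [translate, NFormula.bound, insert_union] using insert_subset_insert x h2
    · simp only [translate, NFormula.qr]
      omega
  | all x φ ih =>
    obtain ⟨h1, h2, h3⟩ := ih fun i t ht => h i t (ht.trans (subset_insert _ _))
    refine ⟨fun y hy => ?_, ?_, ?_⟩
    · have := @h1 y
      simp only [translate, NFormula.free, mem_erase, mem_union] at hy this ⊢
      tauto
    · simpa only [translate, NFormula.bound, insert_union] using insert_subset_insert x h2
    · simp only [translate, NFormula.qr]
      omega

/-- The expansion of `A` by the colour classes of the function `col`. -/
@[reducible]
def expand {U : Type w} (A : L.Structure U) (col : U → Fin k) : (withColors L k).Structure U where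
  funMap := fun
    | Sum.inl f, xs => A.funMap f xs
    | Sum.inr f, _ => Empty.elim f
  RelMap := fun
    | Sum.inl R, xs => A.RelMap R xs
    | Sum.inr (.color i), xs => col (xs 0) = i

theorem isColoring_expand {U : Type w} (A : L.Structure U) (col : U → Fin k) :
    IsColoring A (expand A col) :=
  ⟨rfl, fun a => ⟨col a, rfl, fun _ h => Eq.symm h⟩⟩

/-- The colour symbols are the only new ones, so a colouring amounts to a function into `Fin k`. -/
theorem IsColoring.eq_expand {U : Type w} {A : L.Structure U} {B : (withColors L k).Structure U}
    (h : IsColoring A B) : ∃ col : U → Fin k, B = expand A col := by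
  obtain ⟨rfl, h⟩ := h
  choose col h1 h2 using h
  refine ⟨col, ?_⟩
  ext n f xs
  · rcases f with f | f
    · rfl
    · exact Empty.elim f
  · rcases f with f | f
    · rfl
    · obtain ⟨i⟩ : ColorRel k _ := f
      have hxs : xs = ![xs 0] := by
        funext j
        rw [Subsingleton.elim j 0]
        rfl
      rw [hxs]
      exact ⟨fun hi => (h2 _ i hi).symm, fun hi => hi ▸ h1 (xs 0)⟩

/-! ### Truth under translation and dependence on few colours. -/

section Semantics

variable {U : Type w} [A : L.Structure U] (col : U → Fin k)

theorem realize_eraseTerm (e : ℕ → U) : ∀ t : (withColors L k).Term ℕ,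
    (eraseTerm t).realize e = @Term.realize _ U (expand A col) _ e t
  | .var x => rfl
  | .func (Sum.inl f) ts => by
    simp only [eraseTerm, Term.realize, realize_eraseTerm e]
    rfl
  | .func (Sum.inr f) _ => Empty.elim f

/-- If `χ` describes the colouring, then the translation preserves truth. -/
theorem realize_translate (N : ℕ) (e₀ : ℕ → U)
    (h : ∀ i (t : L.Term ℕ) (e : ℕ → U), (∀ x ∈ t.varFinset, x < N) → (∀ x, N ≤ x → e x = e₀ x) →
      ((χ i t).Realize e ↔ col (t.realize e) = i))
    (φ : NFormula (withColors L k)) (hφ : ∀ x ∈ φ.vars, x < N) (e : ℕ → U)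
    (he : ∀ x, N ≤ x → e x = e₀ x) :
    (translate χ φ).Realize e ↔ @NFormula.Realize _ U (expand A col) φ e := by
  -- Quantifiers of `φ` bind only variables below `N`, so parameters stored from `N` on survive.
  have upd : ∀ (e : ℕ → U) (y : ℕ) (a : U), y < N → (∀ x, N ≤ x → e x = e₀ x) →
      ∀ x, N ≤ x → Function.update e y a x = e₀ x := by
    intro e y a hy he x hx
    rw [Function.update_of_ne (by omega)]
    exact he x hx
  induction φ generalizing e with
  | equal s t => simp only [translate, NFormula.Realize, realize_eraseTerm col]
  | rel R ts =>
    rcases R with R | R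
    · simp only [translate, NFormula.Realize, realize_eraseTerm col]
      rfl
    · obtain ⟨i⟩ : ColorRel k _ := R
      simp only [translate, NFormula.Realize]
      rw [h i _ e _ he, realize_eraseTerm col]
      · rfl
      · intro x hx
        rw [varFinset_eraseTerm] at hx
        exact hφ x (mem_biUnion.2 ⟨0, mem_univ 0, hx⟩)
  | neg φ ih => exact not_congr (ih hφ e he)
  | and φ ψ ih₁ ih₂ =>
    exact and_congr (ih₁ (fun x hx => hφ x (mem_union_left _ hx)) e he)
      (ih₂ (fun x hx => hφ x (mem_union_right _ hx)) e he)
  | or φ ψ ih₁ ih₂ =>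
    exact or_congr (ih₁ (fun x hx => hφ x (mem_union_left _ hx)) e he)
      (ih₂ (fun x hx => hφ x (mem_union_right _ hx)) e he)
  | ex y φ ih =>
    exact exists_congr fun a => ih (fun x hx => hφ x (mem_insert_of_mem hx)) _
      (upd e y a (hφ y (mem_insert_self _ _)) he)
  | all y φ ih =>
    exact forall_congr' fun a => ih (fun x hx => hφ x (mem_insert_of_mem hx)) _
      (upd e y a (hφ y (mem_insert_self _ _)) he)

theorem realize_expand_of_colorFree (col' : U → Fin k) (φ : NFormula (withColors L k))
    (hφ : φ.ColorFree) (e : ℕ → U) :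
    @NFormula.Realize _ U (expand A col) φ e ↔ @NFormula.Realize _ U (expand A col') φ e := by
  induction φ generalizing e with
  | equal s t => simp only [NFormula.Realize, ← realize_eraseTerm]
  | rel R ts =>
    rcases R with R | R
    · simp only [NFormula.Realize, ← realize_eraseTerm]
      rfl
    · exact absurd rfl (hφ R)
  | neg φ ih => exact not_congr (ih hφ e)
  | and φ ψ ih₁ ih₂ => exact and_congr (ih₁ hφ.1 e) (ih₂ hφ.2 e)
  | or φ ψ ih₁ ih₂ => exact or_congr (ih₁ hφ.1 e) (ih₂ hφ.2 e)
  | ex x φ ih => exact exists_congr fun a => ih hφ _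
  | all x φ ih => exact forall_congr' fun a => ih hφ _

/-- The number of relational atoms. -/
def numAtoms : NFormula (withColors L k) → ℕ
  | .equal _ _ => 0
  | .rel _ _ => 1
  | .neg φ => numAtoms φ
  | .and φ ψ => numAtoms φ + numAtoms ψ
  | .or φ ψ => numAtoms φ + numAtoms ψ
  | .ex _ φ => numAtoms φ
  | .all _ φ => numAtoms φ

/-- A colour atom reads the colour of one element, any other atom reads none. The equivalence serves
negated atoms too. -/
theorem exists_realize_rel_iff {n : ℕ} (R : (withColors L k).Relations n)
    (ts : Fin n → (withColors L k).Term ℕ) (e : ℕ → U) :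
    ∃ X : Finset U, #X ≤ 1 ∧ ∀ col' : U → Fin k, (∀ a ∈ X, col' a = col a) →
      (@NFormula.Realize _ U (expand A col) (.rel R ts) e ↔
        @NFormula.Realize _ U (expand A col') (.rel R ts) e) := by
  rcases R with R | R
  · refine ⟨∅, by simp, fun col' _ => ?_⟩
    simp only [NFormula.Realize, ← realize_eraseTerm]
    rfl
  · obtain ⟨i⟩ : ColorRel k _ := R
    refine ⟨{(eraseTerm (ts 0)).realize e}, by simp, fun col' h => ?_⟩
    have := h _ (mem_singleton_self _)
    simp only [NFormula.Realize, ← realize_eraseTerm]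
    change col _ = i ↔ col' _ = i
    rw [this]

/-- The truth of a formula without colours in universal scopes depends on the colours of few
elements only. -/
theorem exists_witnesses (φ : NFormula (withColors L k)) (hnnf : φ.IsNNF)
    (hφ : φ.NoColorInUniversalScope) (e : ℕ → U) (h : @NFormula.Realize _ U (expand A col) φ e) :
    ∃ X : Finset U, #X ≤ numAtoms φ ∧ ∀ col' : U → Fin k, (∀ a ∈ X, col' a = col a) →
      @NFormula.Realize _ U (expand A col') φ e := by
  classical
  induction φ generalizing e with
  | equal s t =>
    exact ⟨∅, by simp, fun col' _ =>
      (realize_expand_of_colorFree col col' (.equal s t) trivial e).1 h⟩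
  | rel R ts =>
    obtain ⟨X, hX, h'⟩ := exists_realize_rel_iff col R ts e
    exact ⟨X, hX, fun col' hc => (h' col' hc).1 h⟩
  | neg φ ih =>
    cases φ with
    | equal s t =>
      exact ⟨∅, by simp, fun col' _ =>
        (realize_expand_of_colorFree col col' (.neg (.equal s t)) trivial e).1 h⟩
    | rel R ts =>
      obtain ⟨X, hX, h'⟩ := exists_realize_rel_iff col R ts e
      exact ⟨X, hX, fun col' hc => (not_congr (h' col' hc)).1 h⟩
    | _ => exact hnnf.elim
  | and φ ψ ih₁ ih₂ =>
    obtain ⟨X, hX, h₁⟩ := ih₁ hnnf.1 hφ.1 e h.1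
    obtain ⟨Y, hY, h₂⟩ := ih₂ hnnf.2 hφ.2 e h.2
    exact ⟨X ∪ Y, (card_union_le X Y).trans (add_le_add hX hY), fun col' hc =>
      ⟨h₁ col' fun a ha => hc a (mem_union_left _ ha),
        h₂ col' fun a ha => hc a (mem_union_right _ ha)⟩⟩
  | or φ ψ ih₁ ih₂ =>
    rcases h with h | h
    · obtain ⟨X, hX, h₁⟩ := ih₁ hnnf.1 hφ.1 e h
      exact ⟨X, hX.trans (Nat.le_add_right _ _), fun col' hc => Or.inl (h₁ col' hc)⟩
    · obtain ⟨X, hX, h₁⟩ := ih₂ hnnf.2 hφ.2 e h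
      exact ⟨X, hX.trans (Nat.le_add_left _ _), fun col' hc => Or.inr (h₁ col' hc)⟩
  | ex x φ ih =>
    obtain ⟨a, ha⟩ := h
    obtain ⟨X, hX, h₁⟩ := ih hnnf hφ _ ha
    exact ⟨X, hX, fun col' hc => ⟨a, h₁ col' hc⟩⟩
  | all x φ ih =>
    exact ⟨∅, by simp, fun col' _ =>
      (realize_expand_of_colorFree col col' (.all x φ) hφ e).1 h⟩

end Semantics

end Translate

/-! ### Arithmetic in finite ordered structures. -/

namespace ArithmeticSignature

open NFormula

variable (τ : ArithmeticSignature L)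

namespace IsStruc

variable {τ} {U : Type w} [L.Structure U] (h : τ.IsStruc U)
include h

theorem index_lt_index {a b : U} (hab : τ.Lt a b) : τ.index a < τ.index b := by
  have := h.finite
  exact Set.ncard_lt_ncard ⟨fun c hc => h.trans c a b hc hab, fun hs => h.irrefl a (hs hab)⟩
    (Set.toFinite _)

theorem lt_iff {a b : U} : τ.Lt a b ↔ τ.index a < τ.index b := by
  refine ⟨h.index_lt_index, fun hab => ?_⟩
  rcases h.total a b with h1 | rfl | h1
  · exact h1
  · exact absurd hab (lt_irrefl _)
  · exact absurd (h.index_lt_index h1) hab.not_gt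

theorem index_injective : Function.Injective (τ.index : U → ℕ) := by
  intro a b hab
  rcases h.total a b with h1 | h1 | h1
  · exact absurd hab (h.index_lt_index h1).ne
  · exact h1
  · exact absurd hab (h.index_lt_index h1).ne'

theorem index_lt_card (a : U) : τ.index a < Nat.card U := by
  have := h.finite
  rw [← Set.ncard_univ]
  exact Set.ncard_lt_ncard ⟨Set.subset_univ _, fun hs => h.irrefl a (hs (Set.mem_univ a))⟩
    (Set.toFinite _)

theorem exists_index_eq {i : ℕ} (hi : i < Nat.card U) : ∃ a : U, τ.index a = i := by
  have := h.finite
  have hinj : Function.Injective fun a : U => (⟨τ.index a, h.index_lt_card a⟩ : Fin (Nat.card U)) :=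
    fun a b hab => h.index_injective (Fin.mk.inj hab)
  obtain ⟨a, ha⟩ := (Function.Injective.bijective_of_nat_card_le hinj (by simp)).2 ⟨i, hi⟩
  exact ⟨a, Fin.mk.inj ha⟩

theorem index_zero : τ.index (τ.zero : U) = 0 := by
  rw [index, Set.eq_empty_of_forall_notMem (s := {b : U | τ.Lt b τ.zero}) fun a => h.zero_min a,
    Set.ncard_empty]

theorem index_succ {a : U} (ha : τ.index a + 1 < Nat.card U) :
    τ.index (Structure.funMap τ.succ ![a]) = τ.index a + 1 := by
  obtain ⟨b, hb⟩ := h.exists_index_eq ha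
  obtain ⟨h1, h2⟩ := h.succ_next a b (h.lt_iff.2 (by omega))
  rw [h.lt_iff] at h1 h2
  omega

theorem index_numeral (e : ℕ → U) {j : ℕ} (hj : j < Nat.card U) :
    τ.index ((τ.numeral j).realize e) = j := by
  induction j with
  | zero => rw [numeral, Term.realize_constants, h.index_zero]
  | succ j ih =>
    have := ih (by omega)
    rw [numeral, Term.realize_functions_apply₁, h.index_succ (by omega), this]

end IsStruc

theorem realize_numeral {U : Type w} [L.Structure U] (j : ℕ) (e e' : ℕ → U) :
    (τ.numeral j).realize e = (τ.numeral j).realize e' :=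
  Term.realize_congr _ (by simp [varFinset_numeral])

/-! ### Defining colours by tables and by the `β` function. -/

/-- The formula `t ∈ {j | g j = i}`. -/
def tableFormula {k n : ℕ} (g : Fin n → Fin k) (i : Fin k) (t : L.Term ℕ) : NFormula L :=
  τ.disj (((List.finRange n).filter (g · = i)).map fun j => .equal t (τ.numeral j))

theorem within_tableFormula {k n : ℕ} (g : Fin n → Fin k) (i : Fin k) (t : L.Term ℕ)
    {S : Finset ℕ} {m : ℕ} : (τ.tableFormula g i t).Within t.varFinset S m := by
  refine τ.within_disj fun φ hφ => ?_
  obtain ⟨j, -, rfl⟩ := List.mem_map.1 hφ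
  exact .equal subset_rfl (by simp [varFinset_numeral])

theorem realize_tableFormula {U : Type w} [L.Structure U] {k n : ℕ} (g : Fin n → Fin k)
    (i : Fin k) (t : L.Term ℕ) (e : ℕ → U) : (τ.tableFormula g i t).Realize e ↔
      ∃ j, g j = i ∧ t.realize e = (τ.numeral j).realize e := by
  simp [tableFormula, realize_disj, Realize]

/-- The matrix of the formula `β`. -/
def betaMatrix (N i : ℕ) (t : L.Term ℕ) : NFormula L :=
  (rel τ.mult ![.var (N + 3), .var N, .var (N + 4)]).and <|
  (rel τ.add ![.var (N + 4), .var (N + 5), t]).and <|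
  (rel τ.lt ![.var (N + 5), .var N]).and <|
  (rel τ.mult ![τ.succ.apply₁ (.var (N + 5)), .var (N + 1), .var (N + 6)]).and <|
  (rel τ.mult ![.var (N + 7), τ.succ.apply₁ (.var (N + 6)), .var (N + 8)]).and <|
  (rel τ.add ![.var (N + 8), τ.numeral i, .var (N + 2)]).and <|
  (rel τ.lt ![τ.numeral i, τ.succ.apply₁ (.var (N + 6))])

/-- The formula `q mod ((t mod p + 1) * b + 1) = i`, where `p`, `b`, `q` are the variables `N`,
`N + 1`, `N + 2`. -/
def betaFormula (N i : ℕ) (t : L.Term ℕ) : NFormula L :=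
  .ex (N + 3) <| .ex (N + 4) <| .ex (N + 5) <| .ex (N + 6) <| .ex (N + 7) <| .ex (N + 8) <|
    τ.betaMatrix N i t

theorem within_betaFormula (N i : ℕ) (t : L.Term ℕ) :
    (τ.betaFormula N i t).Within (t.varFinset ∪ Ico N (N + 3)) (Ico N (N + 9)) 6 := by
  have hsub : t.varFinset ∪ Ico N (N + 9) ⊆ insert (N + 8) (insert (N + 7) (insert (N + 6)
      (insert (N + 5) (insert (N + 4) (insert (N + 3) (t.varFinset ∪ Ico N (N + 3))))))) := by
    intro x hx
    simp only [mem_union, mem_Ico, mem_insert] at hx ⊢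
    by_cases hxt : x ∈ t.varFinset
    · simp [hxt]
    · simp only [hxt, false_or] at hx ⊢
      omega
  have hmat : (τ.betaMatrix N i t).Within (t.varFinset ∪ Ico N (N + 9)) (Ico N (N + 9)) 0 := by
    have hv : ∀ j < 9, (Term.var (N + j) : L.Term ℕ).varFinset ⊆ t.varFinset ∪ Ico N (N + 9) := by
      intro j hj x hx
      simp only [Term.varFinset, mem_singleton, mem_union, mem_Ico] at hx ⊢
      omega
    have ht : t.varFinset ⊆ t.varFinset ∪ Ico N (N + 9) := subset_union_left
    have hn : (τ.numeral i).varFinset ⊆ t.varFinset ∪ Ico N (N + 9) := by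
      simp [varFinset_numeral]
    have hs : ∀ j < 9, (τ.succ.apply₁ (.var (N + j))).varFinset ⊆ t.varFinset ∪ Ico N (N + 9) :=
      fun j hj => (τ.varFinset_apply _).trans_subset (hv j hj)
    have h3 : ∀ {s₀ s₁ s₂ : L.Term ℕ} {F : Finset ℕ}, s₀.varFinset ⊆ F → s₁.varFinset ⊆ F →
        s₂.varFinset ⊆ F → ∀ l : Fin 3, (![s₀, s₁, s₂] l).varFinset ⊆ F := by
      intro s₀ s₁ s₂ F h0 h1 h2 l
      fin_cases l
      exacts [h0, h1, h2]
    have h2 : ∀ {s₀ s₁ : L.Term ℕ} {F : Finset ℕ}, s₀.varFinset ⊆ F → s₁.varFinset ⊆ F →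
        ∀ l : Fin 2, (![s₀, s₁] l).varFinset ⊆ F := by
      intro s₀ s₁ F h0 h1 l
      fin_cases l
      exacts [h0, h1]
    have hv0 := hv 0 (by omega)
    exact (Within.rel (h3 (hv 3 (by omega)) hv0 (hv 4 (by omega)))).and <|
      (Within.rel (h3 (hv 4 (by omega)) (hv 5 (by omega)) ht)).and <|
      (Within.rel (h2 (hv 5 (by omega)) hv0)).and <|
      (Within.rel (h3 (hs 5 (by omega)) (hv 1 (by omega)) (hv 6 (by omega)))).and <|
      (Within.rel (h3 (hv 7 (by omega)) (hs 6 (by omega)) (hv 8 (by omega)))).and <|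
      (Within.rel (h3 (hv 8 (by omega)) hn (hv 2 (by omega)))).and <|
      (Within.rel (h2 hn (hs 6 (by omega))))
  have hm : ∀ j < 9, N + j ∈ Ico N (N + 9) := fun j hj => by simp [hj]
  exact ((((((hmat.mono hsub subset_rfl le_rfl).ex (hm 8 (by omega))).ex (hm 7 (by omega))).ex
    (hm 6 (by omega))).ex (hm 5 (by omega))).ex (hm 4 (by omega))).ex (hm 3 (by omega))

section

variable {U : Type w} [L.Structure U]

theorem _root_.ColorCoding.NFormula.realize_rel₂ {R : L.Relations 2} {s t : L.Term ℕ}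
    {e : ℕ → U} : (NFormula.rel R ![s, t]).Realize e ↔
      Structure.RelMap R ![s.realize e, t.realize e] := by
  rw [Realize]
  refine Eq.to_iff (congrArg _ (funext fun i => ?_))
  fin_cases i <;> rfl

theorem _root_.ColorCoding.NFormula.realize_rel₃ {R : L.Relations 3} {r s t : L.Term ℕ}
    {e : ℕ → U} : (NFormula.rel R ![r, s, t]).Realize e ↔
      Structure.RelMap R ![r.realize e, s.realize e, t.realize e] := by
  rw [Realize]
  refine Eq.to_iff (congrArg _ (funext fun i => ?_))
  fin_cases i <;> rfl

/-- The relation that the formula `β` defines in a structure. -/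
def Beta (p b q c a : U) : Prop :=
  ∃ d e r u d' e' : U, Structure.RelMap τ.mult ![d, p, e] ∧ Structure.RelMap τ.add ![e, r, a] ∧
    τ.Lt r p ∧ Structure.RelMap τ.mult ![Structure.funMap τ.succ ![r], b, u] ∧
    Structure.RelMap τ.mult ![d', Structure.funMap τ.succ ![u], e'] ∧
    Structure.RelMap τ.add ![e', c, q] ∧ τ.Lt c (Structure.funMap τ.succ ![u])

theorem realize_betaFormula (N i : ℕ) (t : L.Term ℕ) (ht : ∀ x ∈ t.varFinset, x < N)
    (e : ℕ → U) : (τ.betaFormula N i t).Realize e ↔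
      τ.Beta (e N) (e (N + 1)) (e (N + 2)) ((τ.numeral i).realize e) (t.realize e) := by
  simp only [betaFormula, Realize, Beta]
  refine exists_congr fun a₃ => exists_congr fun a₄ => exists_congr fun a₅ =>
    exists_congr fun a₆ => exists_congr fun a₇ => exists_congr fun a₈ => ?_
  set E := Function.update (Function.update (Function.update (Function.update (Function.update
    (Function.update e (N + 3) a₃) (N + 4) a₄) (N + 5) a₅) (N + 6) a₆) (N + 7) a₇) (N + 8) a₈
    with hE
  have hlt : ∀ x < N + 3, E x = e x := by
    intro x hx
    simp only [hE]
    iterate 6 rw [Function.update_of_ne (by omega)]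
  have hT : t.realize E = t.realize e :=
    Term.realize_congr t fun x hx => hlt x (by have := ht x hx; omega)
  have hN : E N = e N := hlt _ (by omega)
  have hN1 : E (N + 1) = e (N + 1) := hlt _ (by omega)
  have hN2 : E (N + 2) = e (N + 2) := hlt _ (by omega)
  have h3 : E (N + 3) = a₃ := by simp [hE]
  have h4 : E (N + 4) = a₄ := by simp [hE]
  have h5 : E (N + 5) = a₅ := by simp [hE]
  have h6 : E (N + 6) = a₆ := by simp [hE]
  have h7 : E (N + 7) = a₇ := by simp [hE]
  have h8 : E (N + 8) = a₈ := by simp [hE]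
  clear_value E
  simp only [betaMatrix, Realize.eq_4, realize_rel₂, realize_rel₃, Term.realize_var,
    Term.realize_functions_apply₁, hT, hN, hN1, hN2, h3, h4, h5, h6, h7, h8,
    τ.realize_numeral i E e, Lt]

/-- The elements encode two divisions with remainder. The bound `hn` ensures that the modulus exists
in the universe, so that `succ` does not saturate at the maximum. -/
theorem IsStruc.beta_iff {τ : ArithmeticSignature L} (h : τ.IsStruc U) {p b q c a : U}
    (hp : 0 < τ.index p)
    (hn : (τ.index a % τ.index p + 1) * τ.index b + 1 < Nat.card U) : τ.Beta p b q c a ↔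
      τ.index c < (τ.index a % τ.index p + 1) * τ.index b + 1 ∧
      τ.index q % ((τ.index a % τ.index p + 1) * τ.index b + 1) = τ.index c := by
  have hmod := Nat.mod_lt (τ.index a) hp
  have hpn := h.index_lt_card p
  simp only [Beta, h.add_iff, h.mult_iff, h.lt_iff]
  constructor
  · rintro ⟨d, e, r, u, d', e', h1, h2, h3, h4, h5, h6, h7⟩
    have hr : τ.index a % τ.index p = τ.index r := by
      rw [← h2, ← h1, Nat.mul_add_mod', Nat.mod_eq_of_lt h3]
    rw [h.index_succ (by omega), ← hr] at h4
    rw [h.index_succ (by omega)] at h5 h7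
    rw [h4]
    refine ⟨h7, ?_⟩
    rw [← h6, ← h5, Nat.mul_add_mod', Nat.mod_eq_of_lt h7]
  · rintro ⟨h1, h2⟩
    -- Quotients and their multiples are at most the dividend, hence are indices of elements.
    have hle : ∀ {x : ℕ} {y : U}, x ≤ τ.index y → ∃ z : U, τ.index z = x :=
      fun {x y} hx => h.exists_index_eq (hx.trans_lt (h.index_lt_card y))
    obtain ⟨d, hd⟩ := hle (Nat.div_le_self (τ.index a) (τ.index p))
    obtain ⟨e, he⟩ := hle (Nat.div_mul_le_self (τ.index a) (τ.index p))
    obtain ⟨r, hr⟩ := hle hmod.le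
    obtain ⟨u, hu⟩ := h.exists_index_eq (Nat.lt_of_succ_lt hn)
    rw [← hu] at h1 h2 hn
    obtain ⟨d', hd'⟩ := hle (Nat.div_le_self (τ.index q) (τ.index u + 1))
    obtain ⟨e', he'⟩ := hle (Nat.div_mul_le_self (τ.index q) (τ.index u + 1))
    refine ⟨d, e, r, u, d', e', by rw [hd, he], ?_, by rwa [hr], ?_, ?_, ?_, ?_⟩
    · rw [he, hr, Nat.div_add_mod']
    · rw [h.index_succ (by omega), hr, hu]
    · rw [h.index_succ hn, hd', he']
    · rw [he', ← h2, Nat.div_add_mod']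
    · rwa [h.index_succ hn]

end

/-! ### Eliminating the colours. -/

/-- Any family of definable sets gives rise to a colouring; a set of elements on which the family
is a partition already keeps its colours. -/
theorem exists_coloring_of_family {U : Type w} [A : L.Structure U] {k : ℕ} (hk : 0 < k) (N : ℕ)
    (e₀ : ℕ → U) (Q : Fin k → L.Term ℕ → NFormula L) (P : Fin k → U → Prop)
    (hQ : ∀ i (t : L.Term ℕ) (e : ℕ → U), (∀ x ∈ t.varFinset, x < N) →
      (∀ x, N ≤ x → e x = e₀ x) → ((Q i t).Realize e ↔ P i (t.realize e)))
    (φ : NFormula (withColors L k)) (hφ : ∀ x ∈ φ.vars, x < N) :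
    ∃ col : U → Fin k, (∀ a c, (∀ i, P i a ↔ c = i) → col a = c) ∧
      ((translate (fun i t => τ.least (Q · t) i) φ).Realize e₀ ↔
        @NFormula.Realize _ U (expand A col) φ e₀) := by
  choose col h1 h2 using fun a => existsUnique_least hk (P · a)
  refine ⟨col, fun a c hc => (h2 a c ((least_iff_of_forall hc c).2 rfl)).symm,
    realize_translate _ col N e₀ (fun i t e ht he => ?_) φ hφ e₀ fun _ _ => rfl⟩
  simp only [realize_least, hQ _ t e ht he]
  exact ⟨fun h => (h2 _ i h).symm, fun h => h ▸ h1 _⟩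

/-- Small universes are coloured by a table, large ones by the `β` function. -/
noncomputable def eliminate {k : ℕ} (N₀ N : ℕ) (φ : NFormula (withColors L k)) : NFormula L :=
  -- No test of the universe's size is needed: both disjuncts are sound in every structure.
  (((τ.disj ((univ : Finset (Fin N₀ → Fin k)).toList.map fun g =>
      translate (fun i t => τ.least (τ.tableFormula g · t) i) φ)).or
    (.ex N <| .ex (N + 1) <| .ex (N + 2) <|
      translate (fun i t => τ.least (fun j : Fin k => τ.betaFormula N j t) i) φ))).and
  -- With no colours, a nonempty universe has no colouring.
  (if 0 < k then τ.verum else τ.verum.neg)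

/-- Three variables hold the code and six serve the computation; tables add no quantifiers. -/
theorem within_eliminate {k : ℕ} (N₀ N : ℕ) (φ : NFormula (withColors L k))
    (hφ : φ.IsSentence) :
    (τ.eliminate N₀ N φ).Within ∅ (φ.bound ∪ Ico N (N + 9)) (φ.qr + 9) := by
  have hfree : φ.free = ∅ := hφ
  have hm : ∀ j < 9, N + j ∈ φ.bound ∪ Ico N (N + 9) := fun j hj => by simp [hj]
  refine .and (.or (τ.within_disj fun ψ hψ => ?_) ?_) ?_
  · obtain ⟨g, -, rfl⟩ := List.mem_map.1 hψ
    refine (within_translate (F := ∅) (S := Ico N (N + 9)) (n := 9) _ φ fun i t _ => ?_).mono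
      (by simp [hfree]) subset_rfl le_rfl
    exact τ.within_least (fun j => (τ.within_tableFormula g j t).mono subset_union_left
      subset_rfl le_rfl) i
  · have h := within_translate (fun i t => τ.least (fun j : Fin k => τ.betaFormula N j t) i) φ
      fun i t _ => τ.within_least (fun j => τ.within_betaFormula N j t) i
    refine (((h.mono ?_ subset_rfl le_rfl).ex (hm 2 (by omega))).ex (hm 1 (by omega))).ex
      (hm 0 (by omega))
    intro x
    simp only [hfree, mem_union, mem_Ico, mem_insert, notMem_empty, false_or, or_false]
    omega
  · split_ifs
    exacts [τ.within_verum, τ.within_verum.neg]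

/-- The `β` disjunct always retains the quantifiers of `φ`, whereas the list of tables may be empty.
-/
theorem bound_subset_eliminate {k : ℕ} (N₀ N : ℕ) (φ : NFormula (withColors L k)) :
    φ.bound ⊆ (τ.eliminate N₀ N φ).bound := by
  refine subset_union_left.trans' (subset_union_right.trans' ?_)
  exact (bound_subset_translate _ φ).trans ((subset_insert _ _).trans
    ((subset_insert _ _).trans (subset_insert _ _)))

theorem qr_le_eliminate {k : ℕ} (N₀ N : ℕ) (φ : NFormula (withColors L k)) :
    φ.qr ≤ (τ.eliminate N₀ N φ).qr := by
  refine le_trans ?_ (le_max_left _ _)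
  refine le_trans ?_ (le_max_right _ _)
  have := qr_le_translate (fun i t => τ.least (fun j : Fin k => τ.betaFormula N j t) i) φ
  simp only [qr]
  omega

section

variable {τ} {U : Type w} [A : L.Structure U] {k : ℕ} {N : ℕ} {φ : NFormula (withColors L k)}

theorem exists_coloring_of_realize_eliminate {N₀ : ℕ} (hφ : ∀ x ∈ φ.vars, x < N)
    (hs : φ.IsSentence) {e : ℕ → U} (h : (τ.eliminate N₀ N φ).Realize e) :
    ∃ col : U → Fin k, @NFormula.Realize _ U (expand A col) φ e := by
  obtain ⟨h, hk⟩ := h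
  have hk : 0 < k := by
    by_contra hk'
    rw [if_neg hk'] at hk
    exact hk (τ.realize_verum e)
  rcases h with h | ⟨p, b, q, h⟩
  · obtain ⟨ψ, hψ, h⟩ := (τ.realize_disj e _).1 h
    obtain ⟨g, -, rfl⟩ := List.mem_map.1 hψ
    obtain ⟨col, -, hcol⟩ := τ.exists_coloring_of_family hk N e (τ.tableFormula g)
      (fun i (a : U) => ∃ j, g j = i ∧ a = (τ.numeral j).realize e)
      (fun i t e' _ _ => by simp only [realize_tableFormula, τ.realize_numeral _ e' e]) φ hφ
    exact ⟨col, hcol.1 h⟩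
  · obtain ⟨col, -, hcol⟩ := τ.exists_coloring_of_family hk N _
      (fun i t => τ.betaFormula N i t)
      (fun i a => τ.Beta _ _ _ ((τ.numeral i).realize e) a) (fun i t e' ht he' => by
        rw [τ.realize_betaFormula N i t ht, he' N le_rfl, he' (N + 1) (by omega),
          he' (N + 2) (by omega), τ.realize_numeral i e' e]) φ hφ
    exact ⟨col, (@NFormula.realize_congr _ U (expand A col) φ _ _
      (by simp [show φ.free = ∅ from hs])).1 (hcol.1 h)⟩

theorem IsStruc.realize_eliminate_of_card_le (hU : τ.IsStruc U) {N₀ : ℕ}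
    (hφ : ∀ x ∈ φ.vars, x < N) (hcard : Nat.card U ≤ N₀) (e : ℕ → U) (col : U → Fin k)
    (h : @NFormula.Realize _ U (expand A col) φ e) : (τ.eliminate N₀ N φ).Realize e := by
  have hk : 0 < k := (col (e 0)).pos
  refine ⟨Or.inl ((τ.realize_disj e _).2 ?_), by rw [if_pos hk]; exact τ.realize_verum e⟩
  -- Numerals past the end of the universe all denote the maximum; colouring by value keeps the
  -- table consistent.
  set g : Fin N₀ → Fin k := fun j => col ((τ.numeral j).realize e) with hg
  refine ⟨_, List.mem_map.2 ⟨g, by simp, rfl⟩, ?_⟩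
  obtain ⟨col', hcol', h'⟩ := τ.exists_coloring_of_family hk N e (τ.tableFormula g)
    (fun i a => ∃ j, g j = i ∧ a = (τ.numeral j).realize e)
    (fun i t e' _ _ => by simp only [realize_tableFormula, τ.realize_numeral _ e' e]) φ hφ
  have heq : col' = col := by
    refine funext fun a => hcol' a _ fun i => ⟨?_, ?_⟩
    · rintro ⟨j, rfl, rfl⟩
      rfl
    · rintro rfl
      have ha := hU.index_lt_card a
      have : a = (τ.numeral (τ.index a)).realize e :=
        hU.index_injective (hU.index_numeral e ha).symm
      exact ⟨⟨τ.index a, ha.trans_le hcard⟩, congrArg col this.symm, this⟩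
  exact h'.2 (heq ▸ h)

theorem IsStruc.realize_eliminate_of_lt_card (hU : τ.IsStruc U) {N₀ N₁ : ℕ}
    (hφ : ∀ x ∈ φ.vars, x < N) (hs : φ.IsSentence) (hnnf : φ.IsNNF)
    (hscope : φ.NoColorInUniversalScope) (hkcard : k ≤ Nat.card U)
    (hcode : ∀ n, N₁ < n → ∀ (X : Finset ℕ) (c : ℕ → ℕ), #X ≤ numAtoms φ →
      (∀ x ∈ X, x < n) → (∀ x ∈ X, c x < k) →
      ∃ p b q, 0 < p ∧ p < n ∧ b < n ∧ q < n ∧ ∀ x ∈ X, (x % p + 1) * b + 1 < n ∧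
        c x < (x % p + 1) * b + 1 ∧ q % ((x % p + 1) * b + 1) = c x)
    (hcard : N₁ < Nat.card U) (e : ℕ → U) (col : U → Fin k)
    (h : @NFormula.Realize _ U (expand A col) φ e) : (τ.eliminate N₀ N φ).Realize e := by
  classical
  have hk : 0 < k := (col (e 0)).pos
  refine ⟨Or.inr ?_, by rw [if_pos hk]; exact τ.realize_verum e⟩
  obtain ⟨X, hX, hwit⟩ := exists_witnesses col φ hnnf hscope e h
  -- The colouring is transported to indices, with default 0 elsewhere.
  have hext : ∀ a, Function.extend τ.index (fun a => (col a : ℕ)) 0 (τ.index a) = col a :=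
    fun a => hU.index_injective.extend_apply _ _ a
  obtain ⟨p, b, q, hp, hpn, hbn, hqn, hpbq⟩ := hcode _ hcard (X.image τ.index)
    (Function.extend τ.index (fun a => (col a : ℕ)) 0) (card_image_le.trans hX)
    (by
      intro x hx
      obtain ⟨a, -, rfl⟩ := mem_image.1 hx
      exact hU.index_lt_card a)
    (by
      intro x hx
      obtain ⟨a, -, rfl⟩ := mem_image.1 hx
      rw [hext]
      exact (col a).2)
  obtain ⟨p, rfl⟩ := hU.exists_index_eq hpn
  obtain ⟨b, rfl⟩ := hU.exists_index_eq hbn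
  obtain ⟨q, rfl⟩ := hU.exists_index_eq hqn
  refine ⟨p, b, q, ?_⟩
  obtain ⟨col', hcol', h'⟩ := τ.exists_coloring_of_family hk N
    (Function.update (Function.update (Function.update e N p) (N + 1) b) (N + 2) q)
    (fun i t => τ.betaFormula N i t)
    (fun i a => τ.Beta p b q ((τ.numeral i).realize e) a) (fun i t e' ht he' => by
      rw [τ.realize_betaFormula N i t ht, he' N le_rfl, he' (N + 1) (by omega),
        he' (N + 2) (by omega), τ.realize_numeral i e' e]
      simp) φ hφ
  refine h'.2 ((@NFormula.realize_congr _ U (expand A col') φ _ _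
    (by simp [show φ.free = ∅ from hs])).1 (hwit col' fun a ha => hcol' a _ fun i => ?_))
  obtain ⟨h1, h2, h3⟩ := hpbq _ (mem_image_of_mem _ ha)
  rw [hext] at h2 h3
  -- By `k ≤ Nat.card U` the numeral of each colour has the right index.
  rw [hU.beta_iff hp h1, hU.index_numeral e (i.2.trans_le hkcard), h3, Fin.ext_iff]
  exact ⟨fun h => h.2, fun h => ⟨h ▸ h2, h⟩⟩

end

end ArithmeticSignature

end ColorCoding

/-! ### The main theorem. -/

open ColorCoding
theorem mainTheorem1 :
    ∃ c : ℕ, ∀ (L : FirstOrder.Language.{u, v}) (τ : ArithmeticSignature L) (k : ℕ)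
      (φ : NFormula (withColors L k)),
      φ.IsSentence → φ.IsNNF → φ.NoColorInUniversalScope →
      ∃ φ' : NFormula L, φ'.IsSentence ∧
        (∀ (U : Type w) [A : L.Structure U], τ.IsStruc U →
          (Models U φ' ↔
            ∃ B : (withColors L k).Structure U, IsColoring A B ∧ Models (L := withColors L k) U φ)) ∧
        (φ'.qr ≤ φ.qr + c ∧ φ.qr ≤ φ'.qr + c) ∧
        (φ'.bound.card ≤ φ.bound.card + c ∧ φ.bound.card ≤ φ'.bound.card + c) := by
  refine ⟨9, fun L τ k φ hs hnnf hscope => ?_⟩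
  obtain ⟨N₁, hcode⟩ := exists_coloring_code (numAtoms φ) k
  obtain ⟨N, hN⟩ : ∃ N, ∀ x ∈ φ.vars, x < N :=
    ⟨φ.vars.sup id + 1, fun x hx => Nat.lt_succ_of_le (Finset.le_sup (f := id) hx)⟩
  -- Above `N₁` codes exist; above `k` distinct colours have distinct numerals.
  have hwithin := τ.within_eliminate (max N₁ k) N φ hs
  have hs' : (τ.eliminate (max N₁ k) N φ).IsSentence :=
    Finset.subset_empty.1 hwithin.free_subset
  refine ⟨τ.eliminate (max N₁ k) N φ, hs', ?_,
    ⟨hwithin.qr_le, (τ.qr_le_eliminate _ N φ).trans (Nat.le_add_right _ _)⟩, ?_,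
    (Finset.card_le_card (τ.bound_subset_eliminate _ N φ)).trans (Nat.le_add_right _ _)⟩
  · intro U A hU
    let e : ℕ → U := fun _ => τ.zero
    rw [hs'.models_iff e]
    constructor
    · intro h
      obtain ⟨col, hcol⟩ := ArithmeticSignature.exists_coloring_of_realize_eliminate hN hs h
      exact ⟨expand A col, isColoring_expand A col,
        (@NFormula.IsSentence.models_iff _ U (expand A col) φ hs e).2 hcol⟩
    · rintro ⟨B, hB, h⟩
      obtain ⟨col, rfl⟩ := hB.eq_expand
      rcases le_or_gt (Nat.card U) (max N₁ k) with hc | hc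
      · exact hU.realize_eliminate_of_card_le hN hc e col (h e)
      · exact hU.realize_eliminate_of_lt_card hN hs hnnf hscope
          ((le_max_right _ _).trans hc.le) hcode ((le_max_left _ _).trans_lt hc) e col (h e)
  · refine (Finset.card_le_card hwithin.bound_subset).trans ((Finset.card_union_le _ _).trans ?_)
    simp
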